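/- Let $\Omega$ be a nonempty compact Hausdorff space and let $X\neq\{0\}$ be a real or complex Banach space. Let $\mathrm{WC}(\Omega,X)$ be the space of functions $f:\Omega\to X$ that are continuous for the weak topology of $X$, with the norm $\|f\|=\sup_{\omega\in\Omega}\|f(\omega)\|$. For a normed space $E$, let $E_1^*$ be the closed unit ball of $E^*$, and call $\varphi\in E_1^*$ a w$^*$-w PC if the identity map $(E_1^*,w^*)\to(E_1^*,w)$ is continuous at $\varphi$, where $w^*=\sigma(E^*,E)$ and $w=\sigma(E^*,E^{**})$. For $\omega\in\Omega$ and $x^*\in X^*$, let $\delta_\omega\otimes x^*$ be the functional $f\mapsto x^*(f(\omega))$ on $\mathrm{WC}(\Omega,X)$. If $\Lambda\in \mathrm{WC}(\Omega,X)_1^*$ is a w$^*$-w PC, then there are a finite or countably infinite index set $J\subseteq\mathbb N$, distinct isolated points $\omega_i$ of $\Omega$, numbers $\alpha_i\in(0,1]$ and functionals $x_i^*\in X_1^*$ $(i\in J)$ such that $\sum_{i\in J}\alpha_i=1$, each $x_i^*$ is a w$^*$-w PC of $X_1^*$, and $$\Lambda=\sum_{i\in J}\alpha_i\,\delta_{\omega_i}\otimes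 x_i^*,$$ the series converging in the norm of $\mathrm{WC}(\Omega,X)^*$. -/

import Mathlib

open scoped ENNReal Topology

noncomputable section

/-- `WC 𝕜 Ω X` is the space of functions `Ω → X` that are continuous when `X` carries its weak
topology, with the supremum norm (the norm of `ℓ^∞(Ω, X)`). For compact `Ω` boundedness is
automatic, see `WC.exists_coe_eq`. -/
def WC (𝕜 : Type*) [RCLike 𝕜] (Ω : Type*) [TopologicalSpace Ω]
    (X : Type*) [NormedAddCommGroup X] [NormedSpace 𝕜 X] :
    Submodule 𝕜 (lp (fun _ : Ω => X) ∞) where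
  carrier := {f | Continuous fun t : Ω => toWeakSpace 𝕜 X (f t)}
  zero_mem' := by
    simpa using (continuous_const : Continuous fun _ : Ω => toWeakSpace 𝕜 X 0)
  add_mem' := by
    intro f g hf hg
    exact (Continuous.add (Set.mem_ofPred_eq ▸ hf) (Set.mem_ofPred_eq ▸ hg) :)
  smul_mem' := by
    intro c f hf
    exact (Continuous.const_smul (Set.mem_ofPred_eq ▸ hf) c :)

/-- Every weakly continuous function on a compact space is the underlying function of an element
of `WC 𝕜 Ω X`. -/
theorem WC.exists_coe_eq {𝕜 : Type*} [RCLike 𝕜] {Ω : Type*} [TopologicalSpace Ω] [CompactSpace Ω]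
    {X : Type*} [NormedAddCommGroup X] [NormedSpace 𝕜 X]
    (f : Ω → X) (hf : Continuous fun t : Ω => toWeakSpace 𝕜 X (f t)) :
    ∃ g : WC 𝕜 Ω X, ∀ t, g.1 t = f t := by
  have hb : ∃ C, ∀ t, ‖NormedSpace.inclusionInDoubleDual 𝕜 X (f t)‖ ≤ C := by
    refine banach_steinhaus fun φ => ?_
    have hc : Continuous fun t => φ (f t) :=
      (WeakBilin.eval_continuous (topDualPairing 𝕜 X).flip φ).comp hf
    obtain ⟨C, hC⟩ := isCompact_univ.exists_bound_of_continuousOn hc.continuousOn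
    exact ⟨C, fun t => by simpa using hC t (Set.mem_univ t)⟩
  obtain ⟨C, hC⟩ := hb
  have hm : Memℓp (E := fun _ : Ω => X) f ∞ := by
    refine memℓp_infty ⟨C, ?_⟩
    rintro _ ⟨t, rfl⟩
    have h := hC t
    rwa [show ‖NormedSpace.inclusionInDoubleDual 𝕜 X (f t)‖ = ‖f t‖ from
      (NormedSpace.inclusionInDoubleDualLi 𝕜 (E := X)).norm_map (f t)] at h
  exact ⟨⟨⟨f, hm⟩, hf⟩, fun _ => rfl⟩

/-- The functional `δ_t ⊗ φ` on `WC 𝕜 Ω X`, that is `f ↦ φ (f t)`. -/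
def WC.diracTensor {𝕜 : Type*} [RCLike 𝕜] {Ω : Type*} [TopologicalSpace Ω]
    {X : Type*} [NormedAddCommGroup X] [NormedSpace 𝕜 X] (t : Ω) (φ : StrongDual 𝕜 X) :
    StrongDual 𝕜 (WC 𝕜 Ω X) :=
  LinearMap.mkContinuous
    { toFun := fun f => φ (f.1 t)
      map_add' := fun f g => by simp
      map_smul' := fun c f => by simp }
    ‖φ‖
    (fun f => (φ.le_opNorm (f.1 t)).trans
      (mul_le_mul_of_nonneg_left (lp.norm_apply_le_norm ENNReal.top_ne_zero f.1 t)
        (norm_nonneg φ)))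

/-- `φ` lies in the closed unit ball of the dual of `E`, and the identity map of that ball, from
the weak* topology to the weak topology of the Banach space `E*`, is continuous at `φ`. -/
def IsWeakStarWeakPC (𝕜 : Type*) [RCLike 𝕜] {E : Type*} [NormedAddCommGroup E] [NormedSpace 𝕜 E]
    (φ : StrongDual 𝕜 E) : Prop :=
  ‖φ‖ ≤ 1 ∧
    ContinuousWithinAt
      (fun ψ : WeakDual 𝕜 E => toWeakSpace 𝕜 (StrongDual 𝕜 E) (WeakDual.toStrongDual ψ))
      {ψ : WeakDual 𝕜 E | ‖WeakDual.toStrongDual ψ‖ ≤ 1}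
      (StrongDual.toWeakDual φ)

end

/-!
Weak* limits of convex combinations of the functionals `δ_t ⊗ φ` fill the unit ball of `WC(Ω, X)*`,
and at a point of continuity `Λ` a weak* limit of a convex set is a norm limit by Mazur's theorem.
Since the span of the `δ_t ⊗ φ` is an isometric copy of `ℓ¹(Ω, X*)`, its closure is complete, and
`Λ = ∑ α_t δ_t ⊗ x_t` is an infinite convex combination. Being a point of continuity passes to each
term of an infinite convex combination, and from `δ_t ⊗ x` to `x`. Finally, if `t` is not isolated,
then `δ_t ⊗ x` is a weak* limit of functionals `δ_s ⊗ x` with `s ≠ t`; were it a point of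
continuity, it would belong to the closed subspace of series not charging `t`, so `x = 0`.
But `0` is a point of continuity only if every functional of the unit ball is one.
-/

lemma exists_bijOn_nat_of_countable {α : Type*} [Nonempty α] {s : Set α} (hs : s.Countable) :
    ∃ (J : Set ℕ) (e : ℕ → α), Set.BijOn e J s := by
  obtain ⟨e, he⟩ := Set.countable_iff_exists_subset_range.1 hs
  obtain ⟨J, -, hJ⟩ := Set.SurjOn.exists_bijOn_subset (f := e) (s := Set.univ) (t := s) (by
    rwa [Set.SurjOn, Set.image_univ])
  exact ⟨J, e, hJ⟩

lemma hasSum_comp_bijOn_iff {α β M : Type*} [AddCommMonoid M] [TopologicalSpace M]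
    {f : α → M} {e : β → α} {J : Set β} {s : Set α} (he : Set.BijOn e J s)
    (hf : Function.support f ⊆ s) {m : M} : HasSum (fun i : J => f (e i)) m ↔ HasSum f m :=
  Function.Injective.hasSum_iff (g := fun i : J => e i) he.injOn.injective fun t ht => by
    by_contra hft
    obtain ⟨i, hi, rfl⟩ := he.surjOn (hf hft)
    exact ht ⟨⟨i, hi⟩, rfl⟩

lemma exists_bijOn_support_hasSum {α 𝕜 V : Type*} [RCLike 𝕜] [AddCommMonoid V] [Module 𝕜 V]
    [TopologicalSpace V] [Nonempty α] {a : α → ℝ} {φ : α → V} {r : ℝ} {v : V} (ha : HasSum a r)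
    (hv : HasSum (fun i => (a i : 𝕜) • φ i) v) :
    ∃ (J : Set ℕ) (e : ℕ → α), Set.BijOn e J (Function.support a) ∧
      HasSum (fun i : J => a (e i)) r ∧ HasSum (fun i : J => (a (e i) : 𝕜) • φ (e i)) v := by
  obtain ⟨J, e, he⟩ := exists_bijOn_nat_of_countable ha.summable.countable_support
  refine ⟨J, e, he, (hasSum_comp_bijOn_iff he subset_rfl).2 ha,
    (hasSum_comp_bijOn_iff (f := fun i => (a i : 𝕜) • φ i) he fun i hi hai => hi ?_).2 hv⟩
  simp only [hai, RCLike.ofReal_zero, zero_smul]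

section ConvexSeries

variable {ι 𝕜 V : Type*} [RCLike 𝕜] [NormedAddCommGroup V] [NormedSpace 𝕜 V]

lemma norm_sub_smul_le_of_hasSum {a : ι → ℝ} {φ : ι → V} {v : V} (ha : ∀ i, 0 ≤ a i)
    (ha_sum : HasSum a 1) (hφ : ∀ i, ‖φ i‖ ≤ 1) (hv : HasSum (fun i => (a i : 𝕜) • φ i) v) (i : ι) :
    ‖v - (a i : 𝕜) • φ i‖ ≤ 1 - a i := by
  classical
  refine (hasSum_ite_sub_hasSum hv i).norm_le_of_bounded (hasSum_ite_sub_hasSum ha_sum i)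
    fun j => ?_
  split_ifs
  · exact norm_zero.le
  · simpa [norm_smul, abs_of_nonneg (ha j)] using mul_le_of_le_one_right (ha j) (hφ j)

lemma exists_smul_eq_of_hasSum_norm [Nonempty ι] {y : ι → V} {r : ℝ}
    (hy : HasSum (fun i => ‖y i‖) r) (hr : r ≤ 1) :
    ∃ (a : ι → ℝ) (x : ι → V), (∀ i, 0 ≤ a i) ∧ HasSum a 1 ∧ (∀ i, ‖x i‖ ≤ 1) ∧
      ∀ i, (a i : 𝕜) • x i = y i := by
  classical
  obtain ⟨i₀⟩ := ‹Nonempty ι›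
  let a : ι → ℝ := fun i => ‖y i‖ + if i = i₀ then 1 - r else 0
  have hya (i : ι) : ‖y i‖ ≤ a i := le_add_of_nonneg_right (by split_ifs <;> linarith)
  have ha (i : ι) : 0 ≤ a i := (norm_nonneg _).trans (hya i)
  refine ⟨a, fun i => (a i : 𝕜)⁻¹ • y i, ha, by simpa using hy.add (hasSum_ite_eq i₀ (1 - r)),
    fun i => ?_, fun i => ?_⟩
  · rw [norm_smul, norm_inv, RCLike.norm_of_nonneg (ha i)]
    exact inv_mul_le_one_of_le₀ (hya i) (ha i)
  · obtain hai | hai := eq_or_ne (a i) 0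
    · have : y i = 0 := norm_le_zero_iff.1 (hai ▸ hya i)
      simp [this]
    · exact smul_inv_smul₀ (by exact_mod_cast hai) _

end ConvexSeries

section LpOne

variable {ι 𝕜 V : Type*} [RCLike 𝕜] {Y : ι → Type*}
  [∀ i, NormedAddCommGroup (Y i)] [∀ i, NormedSpace 𝕜 (Y i)]

lemma hasSum_norm_of_lp_one (y : lp Y 1) : HasSum (fun i => ‖y i‖) ‖y‖ := by
  simpa using lp.hasSum_norm (by simp) y

variable [NormedAddCommGroup V] [NormedSpace 𝕜 V] [CompleteSpace V]

lemma summable_apply_of_norm_sum_apply {d : ∀ i, Y i →ₗ[𝕜] V}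
    (hd : ∀ (F : Finset ι) (y : ∀ i, Y i), ‖∑ i ∈ F, d i (y i)‖ = ∑ i ∈ F, ‖y i‖) (y : lp Y 1) :
    Summable fun i => d i (y i) :=
  (hasSum_norm_of_lp_one y).summable.of_norm_bounded fun i => by simpa using (hd {i} y).le

/-- A family of linear maps `d i : Y i → V` whose finite sums `∑ i, d i (y i)` have norm
`∑ i, ‖y i‖` sums to a linear isometry `y ↦ ∑' i, d i (y i)` on the `ℓ¹`-sum of the `Y i`. -/
noncomputable def lpOneTsumₗᵢ (d : ∀ i, Y i →ₗ[𝕜] V)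
    (hd : ∀ (F : Finset ι) (y : ∀ i, Y i), ‖∑ i ∈ F, d i (y i)‖ = ∑ i ∈ F, ‖y i‖) :
    lp Y 1 →ₗᵢ[𝕜] V where
  toFun y := ∑' i, d i (y i)
  map_add' y z := by
    simpa using (summable_apply_of_norm_sum_apply hd y).tsum_add
      (summable_apply_of_norm_sum_apply hd z)
  map_smul' c y := by
    simpa using (summable_apply_of_norm_sum_apply hd y).tsum_const_smul c
  norm_map' y := tendsto_nhds_unique (summable_apply_of_norm_sum_apply hd y).hasSum.norm
    (by simpa only [hd] using! hasSum_norm_of_lp_one y)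

lemma hasSum_lpOneTsumₗᵢ (d : ∀ i, Y i →ₗ[𝕜] V)
    (hd : ∀ (F : Finset ι) (y : ∀ i, Y i), ‖∑ i ∈ F, d i (y i)‖ = ∑ i ∈ F, ‖y i‖) (y : lp Y 1) :
    HasSum (fun i => d i (y i)) (lpOneTsumₗᵢ d hd y) :=
  (summable_apply_of_norm_sum_apply hd y).hasSum

lemma lpOneTsumₗᵢ_single [DecidableEq ι] (d : ∀ i, Y i →ₗ[𝕜] V)
    (hd : ∀ (F : Finset ι) (y : ∀ i, Y i), ‖∑ i ∈ F, d i (y i)‖ = ∑ i ∈ F, ‖y i‖)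
    (i : ι) (z : Y i) :
    lpOneTsumₗᵢ d hd (lp.single 1 i z) = d i z :=
  (tsum_eq_single i fun j hj => by rw [lp.single_apply_ne _ _ _ hj, map_zero]).trans <| by
    rw [lp.single_apply_self]

end LpOne

lemma tendsto_toWeakSpace_iff {𝕜 E α : Type*} [RCLike 𝕜] [NormedAddCommGroup E] [NormedSpace 𝕜 E]
    {l : Filter α} {f : α → E} {v : E} :
    Filter.Tendsto (fun i => toWeakSpace 𝕜 E (f i)) l (𝓝 (toWeakSpace 𝕜 E v)) ↔
      ∀ Φ : StrongDual 𝕜 E, Filter.Tendsto (fun i => Φ (f i)) l (𝓝 (Φ v)) :=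
  WeakBilin.tendsto_iff_forall_eval_tendsto (B := (topDualPairing 𝕜 E).flip)
    (fun _ _ h => SeparatingDual.eq_iff_forall_dual_eq.2 (LinearMap.congr_fun h))

lemma mem_closure_of_forall_re_le {𝕜 V F : Type*} [RCLike 𝕜] [AddCommGroup V]
    [Module 𝕜 V] [Module ℝ V] [IsScalarTower ℝ 𝕜 V] [AddCommGroup F] [Module 𝕜 F]
    {B : V →ₗ[𝕜] F →ₗ[𝕜] 𝕜} {D : Set (WeakBilin B)} (hD : Convex ℝ D) {φ : WeakBilin B}
    (h : ∀ (e : F) (c : ℝ), (∀ ψ ∈ D, RCLike.re (WeakBilin.eval B e ψ) ≤ c) →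
      RCLike.re (WeakBilin.eval B e φ) ≤ c) : φ ∈ closure D := by
  by_contra hφ
  have : ContinuousSMul ℝ (WeakBilin B) := IsScalarTower.continuousSMul 𝕜
  obtain ⟨g, u, hlt, hgt⟩ := RCLike.geometric_hahn_banach_closed_point (𝕜 := 𝕜)
    hD.closure isClosed_closure hφ
  obtain ⟨e, rfl⟩ := LinearMap.dualEmbedding_surjective B g
  exact (h e u fun ψ hψ => (hlt ψ (subset_closure hψ)).le).not_gt hgt

section Dual

variable {𝕜 E F : Type*} [RCLike 𝕜] [NormedAddCommGroup E] [NormedSpace 𝕜 E]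
  [NormedAddCommGroup F] [NormedSpace 𝕜 F]

lemma exists_norm_le_one_norm_le_re_mul (φ : StrongDual 𝕜 E) {ε : ℝ} (hε : 1 < ε) :
    ∃ v : E, ‖v‖ ≤ 1 ∧ ‖φ‖ ≤ RCLike.re (φ v) * ε := by
  obtain rfl | hφ := eq_or_ne φ 0
  · exact ⟨0, by simp⟩
  obtain ⟨v, hv, hlt⟩ := φ.exists_lt_apply_of_lt_opNorm (div_lt_self (norm_pos_iff.2 hφ) hε)
  obtain ⟨c, hc, hcv⟩ := RCLike.exists_norm_eq_mul_self (φ v)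
  refine ⟨c • v, by simpa [norm_smul, hc] using hv.le, ?_⟩
  rw [map_smul, smul_eq_mul, ← hcv, RCLike.ofReal_re]
  exact ((div_lt_iff₀ (zero_lt_one.trans hε)).1 hlt).le

lemma toWeakDual_mem_closure_of_norming {D : Set (StrongDual 𝕜 E)} (hconv : Convex ℝ D)
    (hnorming : ∀ (e : E) (c : ℝ), (∀ ψ ∈ D, RCLike.re (ψ e) ≤ c) → ‖e‖ ≤ c)
    {φ : StrongDual 𝕜 E} (hφ : ‖φ‖ ≤ 1) :
    StrongDual.toWeakDual φ ∈ closure (WeakDual.toStrongDual ⁻¹' D) :=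
  mem_closure_of_forall_re_le (B := topDualPairing 𝕜 E) (D := D) (φ := φ) hconv fun e c hc =>
    calc RCLike.re (φ e) ≤ ‖φ e‖ := RCLike.re_le_norm _
      _ ≤ ‖e‖ := (φ.le_of_opNorm_le hφ e).trans_eq (one_mul _)
      _ ≤ c := hnorming e c hc

lemma convex_setOf_mem_and_norm_le_one [NormedSpace ℝ E] [IsScalarTower ℝ 𝕜 E]
    (p : Submodule 𝕜 E) : Convex ℝ {v | v ∈ p ∧ ‖v‖ ≤ 1} := by
  have : {v | v ∈ p ∧ ‖v‖ ≤ 1} = (p.restrictScalars ℝ : Set E) ∩ Metric.closedBall 0 1 := by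
    ext; simp
  exact this ▸ (p.restrictScalars ℝ).convex.inter (convex_closedBall 0 1)

lemma exists_comp_eq_of_isometry (T : E →ₗᵢ[𝕜] F) (Φ : StrongDual 𝕜 E) :
    ∃ Ψ : StrongDual 𝕜 F, ∀ v, Ψ (T v) = Φ v := by
  obtain ⟨Ψ, hΨ, -⟩ := exists_extension_norm_eq (LinearMap.range T.toLinearMap)
    (Φ.comp (T.equivRange.symm : _ →L[𝕜] E))
  refine ⟨Ψ, fun v => (hΨ (T.equivRange v)).trans ?_⟩
  exact congrArg Φ (T.equivRange.symm_apply_apply v)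

namespace IsWeakStarWeakPC

lemma mem_of_mem_closure {φ : StrongDual 𝕜 E} (hφ : IsWeakStarWeakPC 𝕜 φ)
    {D : Set (StrongDual 𝕜 E)} (hconv : Convex ℝ D) (hclosed : IsClosed D)
    (hball : ∀ ψ ∈ D, ‖ψ‖ ≤ 1)
    (hmem : StrongDual.toWeakDual φ ∈ closure (WeakDual.toStrongDual ⁻¹' D)) : φ ∈ D := by
  have hweak : toWeakSpace 𝕜 (StrongDual 𝕜 E) φ ∈ closure (toWeakSpace 𝕜 (StrongDual 𝕜 E) '' D) :=
    (hφ.2.mono (s := WeakDual.toStrongDual ⁻¹' D) fun ψ hψ => hball _ hψ).mem_closure hmem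
      fun ψ hψ => Set.mem_image_of_mem _ hψ
  rw [← hconv.toWeakSpace_closure (𝕜 := 𝕜), hclosed.closure_eq] at hweak
  exact ((toWeakSpace 𝕜 (StrongDual 𝕜 E)).injective.mem_set_image).1 hweak

lemma mem_submodule_of_mem_closure {φ : StrongDual 𝕜 E} (hφ : IsWeakStarWeakPC 𝕜 φ)
    {p : Submodule 𝕜 (StrongDual 𝕜 E)} (hp : IsClosed (p : Set (StrongDual 𝕜 E)))
    (hmem : StrongDual.toWeakDual φ ∈
      closure (WeakDual.toStrongDual ⁻¹' {ψ | ψ ∈ p ∧ ‖ψ‖ ≤ 1})) : φ ∈ p :=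
  (hφ.mem_of_mem_closure (convex_setOf_mem_and_norm_le_one p)
    (hp.inter (isClosed_le continuous_norm continuous_const)) (fun _ hψ => hψ.2) hmem).1

lemma mem_submodule_of_norming {φ : StrongDual 𝕜 E} (hφ : IsWeakStarWeakPC 𝕜 φ)
    {p : Submodule 𝕜 (StrongDual 𝕜 E)} (hp : IsClosed (p : Set (StrongDual 𝕜 E)))
    (hnorming : ∀ (e : E) (c : ℝ), (∀ ψ ∈ p, ‖ψ‖ ≤ 1 → RCLike.re (ψ e) ≤ c) → ‖e‖ ≤ c) :
    φ ∈ p :=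
  hφ.mem_submodule_of_mem_closure hp <| toWeakDual_mem_closure_of_norming
    (convex_setOf_mem_and_norm_le_one p)
    (fun e c hc => hnorming e c fun ψ hψp hψ => hc ψ ⟨hψp, hψ⟩) hφ.1

lemma of_norm_sub_smul_le {Λ φ : StrongDual 𝕜 E} (hΛ : IsWeakStarWeakPC 𝕜 Λ) {a : ℝ} (ha : 0 < a)
    (hφ : ‖φ‖ ≤ 1) (hrest : ‖Λ - (a : 𝕜) • φ‖ ≤ 1 - a) : IsWeakStarWeakPC 𝕜 φ := by
  refine ⟨hφ, ?_⟩
  set R := Λ - (a : 𝕜) • φ with hR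
  let G : WeakDual 𝕜 E → WeakDual 𝕜 E := fun ψ => StrongDual.toWeakDual R + (a : 𝕜) • ψ
  have hGφ : G (StrongDual.toWeakDual φ) = StrongDual.toWeakDual Λ := by simp [G, hR]
  have hG : Set.MapsTo G {ψ | ‖WeakDual.toStrongDual ψ‖ ≤ 1}
      {ψ | ‖WeakDual.toStrongDual ψ‖ ≤ 1} := fun ψ hψ =>
    calc ‖R + (a : 𝕜) • WeakDual.toStrongDual ψ‖
        ≤ ‖R‖ + a * ‖WeakDual.toStrongDual ψ‖ := by
          simpa [norm_smul, abs_of_pos ha] using norm_add_le R ((a : 𝕜) • WeakDual.toStrongDual ψ)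
      _ ≤ (1 - a) + a * 1 := by gcongr; exact hψ
      _ = 1 := by ring
  have hcont := ContinuousWithinAt.comp (f := G) (hGφ ▸ hΛ.2)
    (continuous_const.add (continuous_const_smul _)).continuousWithinAt hG
  have ha' : (a : 𝕜) ≠ 0 := by exact_mod_cast ha.ne'
  refine tendsto_toWeakSpace_iff.2 fun Φ => ?_
  have hinv (ψ : StrongDual 𝕜 E) : Φ ψ = (a : 𝕜)⁻¹ * (Φ (R + (a : 𝕜) • ψ) - Φ R) := by
    rw [map_add, add_sub_cancel_left, map_smul, smul_eq_mul, inv_mul_cancel_left₀ ha']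
  have hlim := ((tendsto_toWeakSpace_iff.1 hcont Φ).sub_const (Φ R)).const_mul (a : 𝕜)⁻¹
  exact (hlim.congr fun ψ => (hinv _).symm).trans_eq (congrArg 𝓝 (hinv φ).symm)

lemma of_hasSum_smul {ι : Type*} {Λ : StrongDual 𝕜 E} (hΛ : IsWeakStarWeakPC 𝕜 Λ) {a : ι → ℝ}
    {φ : ι → StrongDual 𝕜 E} (ha : ∀ i, 0 ≤ a i) (ha_sum : HasSum a 1) (hφ : ∀ i, ‖φ i‖ ≤ 1)
    (hsum : HasSum (fun i => (a i : 𝕜) • φ i) Λ) {i : ι} (hi : a i ≠ 0) :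
    IsWeakStarWeakPC 𝕜 (φ i) :=
  hΛ.of_norm_sub_smul_le ((ha i).lt_of_ne' hi) (hφ i)
    (norm_sub_smul_le_of_hasSum ha ha_sum hφ hsum i)

lemma of_zero (h : IsWeakStarWeakPC 𝕜 (0 : StrongDual 𝕜 E)) {φ : StrongDual 𝕜 E}
    (hφ : ‖φ‖ ≤ 1) : IsWeakStarWeakPC 𝕜 φ := by
  refine h.of_norm_sub_smul_le one_half_pos hφ ?_
  rw [zero_sub, norm_neg, norm_smul, RCLike.norm_of_nonneg one_half_pos.le]
  linarith

lemma of_comp {L : E →L[𝕜] F} (hL : ∀ ψ : StrongDual 𝕜 F, ‖ψ.comp L‖ = ‖ψ‖) {φ : StrongDual 𝕜 F}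
    (h : IsWeakStarWeakPC 𝕜 (φ.comp L)) : IsWeakStarWeakPC 𝕜 φ := by
  refine ⟨hL φ ▸ h.1, tendsto_toWeakSpace_iff.2 fun Φ => ?_⟩
  obtain ⟨Ψ, hΨ⟩ := exists_comp_eq_of_isometry ⟨(L.precomp 𝕜).toLinearMap, hL⟩ Φ
  let G : WeakDual 𝕜 F → WeakDual 𝕜 E := fun ψ =>
    StrongDual.toWeakDual ((WeakDual.toStrongDual ψ).comp L)
  have hG : Continuous G :=
    WeakDual.continuous_of_continuous_eval fun v => WeakDual.eval_continuous (L v)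
  have hmaps : Set.MapsTo G {ψ | ‖WeakDual.toStrongDual ψ‖ ≤ 1}
      {ψ | ‖WeakDual.toStrongDual ψ‖ ≤ 1} := fun ψ hψ => (hL _).trans_le hψ
  have := (tendsto_toWeakSpace_iff.1 h.2 Ψ).comp (hG.continuousWithinAt.tendsto_nhdsWithin hmaps)
  exact (hΨ φ ▸ this).congr fun ψ => hΨ _

end IsWeakStarWeakPC

end Dual

lemma exists_continuousMap_forall_mem_eqOn_finset {Ω X : Type*} [TopologicalSpace Ω] [T35Space Ω]
    [AddCommGroup X] [Module ℝ X] [TopologicalSpace X] [IsTopologicalAddGroup X]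
    [ContinuousSMul ℝ X] {K : Set X} (hK : Convex ℝ K) (hK_nonempty : K.Nonempty) (F : Finset Ω)
    {x : Ω → X} (hx : ∀ t ∈ F, x t ∈ K) :
    ∃ f : C(Ω, X), (∀ t, f t ∈ K) ∧ Set.EqOn f x F := by
  classical
  induction F using Finset.induction_on with
  | empty =>
    obtain ⟨v, hv⟩ := hK_nonempty
    exact ⟨.const Ω v, fun _ => hv, by simp⟩
  | insert a s ha ih =>
    obtain ⟨f, hf, hfx⟩ := ih fun t ht => hx t (Finset.mem_insert_of_mem ht)
    obtain ⟨h, hh, hha, hhs⟩ := CompletelyRegularSpace.completely_regular a (s : Set Ω)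
      s.finite_toSet.isClosed (by simpa using ha)
    refine ⟨⟨fun t => AffineMap.lineMap (x a) (f t) (h t : ℝ),
      continuous_const.lineMap f.continuous (continuous_subtype_val.comp hh)⟩,
      fun t => hK.lineMap_mem (hx a (Finset.mem_insert_self a s)) (hf t) (h t).2, fun t ht => ?_⟩
    obtain rfl | ht := Finset.mem_insert.1 ht
    · simp [hha]
    · simp [hhs ht, hfx ht]

namespace WC

variable {𝕜 Ω X : Type*} [RCLike 𝕜] [TopologicalSpace Ω] [NormedAddCommGroup X] [NormedSpace 𝕜 X]

lemma continuous_dual_apply (f : WC 𝕜 Ω X) (φ : StrongDual 𝕜 X) :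
    Continuous fun t => φ (f.1 t) :=
  (WeakBilin.eval_continuous (topDualPairing 𝕜 X).flip φ).comp f.2

lemma continuous_toWeakDual_diracTensor (φ : StrongDual 𝕜 X) :
    Continuous fun t : Ω => StrongDual.toWeakDual (diracTensor t φ : StrongDual 𝕜 (WC 𝕜 Ω X)) :=
  WeakDual.continuous_of_continuous_eval fun f => continuous_dual_apply f φ

variable (𝕜 X) in
/-- Evaluation at `t`, so that `diracTensor t φ = φ ∘ evalCLM 𝕜 X t`. -/
noncomputable def evalCLM (t : Ω) : WC 𝕜 Ω X →L[𝕜] X :=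
  (lp.evalCLM 𝕜 (fun _ : Ω => X) ∞ t).comp (WC 𝕜 Ω X).subtypeL

lemma norm_diracTensor_le (t : Ω) (φ : StrongDual 𝕜 X) :
    ‖(diracTensor t φ : StrongDual 𝕜 (WC 𝕜 Ω X))‖ ≤ ‖φ‖ :=
  LinearMap.mkContinuous_norm_le _ (norm_nonneg φ) _

lemma norm_le_of_forall_re_diracTensor_le [Nonempty Ω] {f : WC 𝕜 Ω X} {c : ℝ}
    (h : ∀ (t : Ω) (φ : StrongDual 𝕜 X), ‖φ‖ ≤ 1 → RCLike.re (diracTensor t φ f) ≤ c) :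
    ‖f‖ ≤ c := by
  refine lp.norm_le_of_forall_le' c fun t => ?_
  obtain ⟨φ, hφ, hφf⟩ := exists_dual_vector'' 𝕜 (f.1 t)
  calc ‖f.1 t‖ = RCLike.re (φ (f.1 t)) := by rw [hφf, RCLike.ofReal_re]
    _ ≤ c := h t φ hφ

section T35Space

variable [T35Space Ω]

lemma exists_norm_le_one_eqOn_finset (F : Finset Ω) {x : Ω → X} (hx : ∀ t ∈ F, ‖x t‖ ≤ 1) :
    ∃ f : WC 𝕜 Ω X, ‖f‖ ≤ 1 ∧ ∀ t ∈ F, f.1 t = x t := by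
  let _ : NormedSpace ℝ X := NormedSpace.restrictScalars ℝ 𝕜 X
  obtain ⟨f, hf, hfx⟩ := exists_continuousMap_forall_mem_eqOn_finset (convex_closedBall (0 : X) 1)
    ⟨0, by simp⟩ F (x := x) (by simpa using hx)
  simp only [mem_closedBall_zero_iff] at hf
  have hmem : Memℓp (E := fun _ : Ω => X) f ∞ := memℓp_infty ⟨1, by rintro _ ⟨t, rfl⟩; exact hf t⟩
  let g : lp (fun _ : Ω => X) ∞ := ⟨⇑f, hmem⟩
  exact ⟨⟨g, (toWeakSpaceCLM 𝕜 X).continuous.comp f.continuous⟩,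
    lp.norm_le_of_forall_le zero_le_one hf, hfx⟩

lemma norm_sum_diracTensor (F : Finset Ω) (y : Ω → StrongDual 𝕜 X) :
    ‖∑ t ∈ F, (diracTensor t (y t) : StrongDual 𝕜 (WC 𝕜 Ω X))‖ = ∑ t ∈ F, ‖y t‖ := by
  set Λ : StrongDual 𝕜 (WC 𝕜 Ω X) := ∑ t ∈ F, diracTensor t (y t) with hΛ
  refine le_antisymm (norm_sum_le_of_le (E := StrongDual 𝕜 (WC 𝕜 Ω X)) F
    fun t _ => norm_diracTensor_le t (y t)) ?_
  refine (le_iff_forall_one_lt_le_mul₀ (norm_nonneg Λ)).2 fun ε hε => ?_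
  choose v hv hεv using fun t => exists_norm_le_one_norm_le_re_mul (y t) hε
  obtain ⟨f, hf, hfv⟩ := exists_norm_le_one_eqOn_finset (𝕜 := 𝕜) F fun t _ => hv t
  have hΛf : Λ f = ∑ t ∈ F, y t (v t) := by
    rw [hΛ, sum_apply]
    exact Finset.sum_congr rfl fun t ht => congrArg (y t) (hfv t ht)
  calc ∑ t ∈ F, ‖y t‖ ≤ ∑ t ∈ F, RCLike.re (y t (v t)) * ε := Finset.sum_le_sum fun t _ => hεv t
    _ = RCLike.re (Λ f) * ε := by rw [hΛf, map_sum, Finset.sum_mul]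
    _ ≤ ‖Λ‖ * ε := by
      gcongr
      exact (RCLike.re_le_norm _).trans (Λ.unit_le_opNorm f hf)

lemma norm_diracTensor (t : Ω) (φ : StrongDual 𝕜 X) :
    ‖(diracTensor t φ : StrongDual 𝕜 (WC 𝕜 Ω X))‖ = ‖φ‖ := by
  simpa using norm_sum_diracTensor {t} fun _ => φ

variable (𝕜 Ω X) in
/-- The isometric embedding `y ↦ ∑ t, δ_t ⊗ y t` of `ℓ¹(Ω, X*)` into `WC(Ω, X)*`. -/
noncomputable def diracSeries :
    lp (fun _ : Ω => StrongDual 𝕜 X) 1 →ₗᵢ[𝕜] StrongDual 𝕜 (WC 𝕜 Ω X) :=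
  lpOneTsumₗᵢ (𝕜 := 𝕜) (V := StrongDual 𝕜 (WC 𝕜 Ω X)) (Y := fun _ : Ω => StrongDual 𝕜 X)
    (fun t => ((evalCLM 𝕜 X t).precomp 𝕜).toLinearMap) norm_sum_diracTensor

lemma diracSeries_single [DecidableEq Ω] (t : Ω) (φ : StrongDual 𝕜 X) :
    diracSeries 𝕜 Ω X (lp.single 1 t φ) = diracTensor t φ :=
  lpOneTsumₗᵢ_single (𝕜 := 𝕜) (V := StrongDual 𝕜 (WC 𝕜 Ω X)) (Y := fun _ : Ω => StrongDual 𝕜 X)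
    _ norm_sum_diracTensor t φ

lemma hasSum_diracSeries (y : lp (fun _ : Ω => StrongDual 𝕜 X) 1) :
    HasSum (fun t => (diracTensor t (y t) : StrongDual 𝕜 (WC 𝕜 Ω X))) (diracSeries 𝕜 Ω X y) := by
  have h := hasSum_lpOneTsumₗᵢ (𝕜 := 𝕜) (V := StrongDual 𝕜 (WC 𝕜 Ω X))
    (Y := fun _ : Ω => StrongDual 𝕜 X) (fun t => ((evalCLM 𝕜 X t).precomp 𝕜).toLinearMap)
    norm_sum_diracTensor y
  exact h

lemma exists_diracSeries_eq [Nonempty Ω] {Λ : StrongDual 𝕜 (WC 𝕜 Ω X)}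
    (hΛ : IsWeakStarWeakPC 𝕜 Λ) : ∃ y, diracSeries 𝕜 Ω X y = Λ := by
  classical
  suffices Λ ∈ (⊤ : Submodule 𝕜 _).map (diracSeries 𝕜 Ω X).toLinearMap by simpa using this
  refine hΛ.mem_submodule_of_norming
    (LinearIsometry.isComplete_map_iff _ |>.2 isClosed_univ.isComplete).isClosed
    fun f c hc => norm_le_of_forall_re_diracTensor_le fun t φ hφ => hc _ ?_ ?_
  · exact ⟨lp.single 1 t φ, trivial, diracSeries_single t φ⟩
  · exact (norm_diracTensor_le t φ).trans hφ

lemma eq_zero_of_isWeakStarWeakPC_diracTensor {t : Ω} (ht : ¬ IsOpen {t}) {φ : StrongDual 𝕜 X}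
    (h : IsWeakStarWeakPC 𝕜 (diracTensor t φ : StrongDual 𝕜 (WC 𝕜 Ω X))) : φ = 0 := by
  classical
  let p := (lp.evalCLM 𝕜 (fun _ : Ω => StrongDual 𝕜 X) 1 t).ker.map (diracSeries 𝕜 Ω X).toLinearMap
  have hp : IsClosed (p : Set (StrongDual 𝕜 (WC 𝕜 Ω X))) :=
    (LinearIsometry.isComplete_map_iff _ |>.2
      (lp.evalCLM 𝕜 (fun _ : Ω => StrongDual 𝕜 X) 1 t).isClosed_ker.isComplete).isClosed
  have ht_mem : t ∈ closure {t}ᶜ := mem_closure_iff_nhdsWithin_neBot.2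
    ⟨fun hbot => ht ((isOpen_singleton_iff_punctured_nhds t).2 hbot)⟩
  have hmaps : Set.MapsTo
      (fun s => StrongDual.toWeakDual (diracTensor s φ : StrongDual 𝕜 (WC 𝕜 Ω X))) {t}ᶜ
      (WeakDual.toStrongDual ⁻¹' {ψ | ψ ∈ p ∧ ‖ψ‖ ≤ 1}) := fun s hs =>
    ⟨⟨lp.single 1 s φ, lp.single_apply_ne 1 _ _ (Ne.symm hs), diracSeries_single s φ⟩,
      (norm_diracTensor s φ).trans_le ((norm_diracTensor t φ).symm.trans_le h.1)⟩
  obtain ⟨y, hy, hyt⟩ := h.mem_submodule_of_mem_closure hp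
    (map_mem_closure (f := fun s => StrongDual.toWeakDual (diracTensor s φ))
      (continuous_toWeakDual_diracTensor φ) ht_mem hmaps)
  have hy_single : y = lp.single 1 t φ :=
    (diracSeries 𝕜 Ω X).injective (hyt.trans (diracSeries_single t φ).symm)
  have hy_zero : y t = 0 := hy
  rwa [hy_single, lp.single_apply_self (E := fun _ : Ω => StrongDual 𝕜 X)] at hy_zero

lemma isOpen_singleton_of_isWeakStarWeakPC_diracTensor [Nontrivial X] {t : Ω} {φ : StrongDual 𝕜 X}
    (h : IsWeakStarWeakPC 𝕜 (diracTensor t φ : StrongDual 𝕜 (WC 𝕜 Ω X))) : IsOpen {t} := by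
  by_contra ht
  obtain rfl := eq_zero_of_isWeakStarWeakPC_diracTensor ht h
  obtain ⟨v, hv⟩ := exists_ne (0 : X)
  obtain ⟨g, hg, -⟩ := exists_dual_vector 𝕜 v (norm_ne_zero_iff.2 hv)
  have : diracTensor t (0 : StrongDual 𝕜 X) = (0 : StrongDual 𝕜 (WC 𝕜 Ω X)) := rfl
  have := eq_zero_of_isWeakStarWeakPC_diracTensor ht
    ((this ▸ h).of_zero ((norm_diracTensor_le t g).trans hg.le))
  simp [this] at hg

lemma exists_hasSum_smul_diracTensor [Nonempty Ω] [Nontrivial X] {Λ : StrongDual 𝕜 (WC 𝕜 Ω X)}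
    (hΛ : IsWeakStarWeakPC 𝕜 Λ) :
    ∃ (a : Ω → ℝ) (x : Ω → StrongDual 𝕜 X), (∀ t, 0 ≤ a t) ∧ HasSum a 1 ∧
      (∀ t, a t ≠ 0 → IsOpen {t} ∧ IsWeakStarWeakPC 𝕜 (x t)) ∧
      HasSum (fun t => (a t : 𝕜) • diracTensor t (x t)) Λ := by
  obtain ⟨y, rfl⟩ := exists_diracSeries_eq hΛ
  have hy : ‖y‖ ≤ 1 := ((diracSeries 𝕜 Ω X).norm_map y).symm.trans_le hΛ.1
  obtain ⟨a, x, ha, ha_sum, hx, hax⟩ :=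
    exists_smul_eq_of_hasSum_norm (𝕜 := 𝕜) (hasSum_norm_of_lp_one y) hy
  have hsum : HasSum (fun t => (a t : 𝕜) • (diracTensor t (x t) : StrongDual 𝕜 (WC 𝕜 Ω X)))
      (diracSeries 𝕜 Ω X y) := by
    convert hasSum_diracSeries y with t
    rw [← hax]; rfl
  refine ⟨a, x, ha, ha_sum, fun t hat => ?_, hsum⟩
  have hdirac : IsWeakStarWeakPC 𝕜 (diracTensor t (x t) : StrongDual 𝕜 (WC 𝕜 Ω X)) :=
    hΛ.of_hasSum_smul ha ha_sum (fun s => (norm_diracTensor_le s (x s)).trans (hx s)) hsum hat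
  exact ⟨isOpen_singleton_of_isWeakStarWeakPC_diracTensor hdirac,
    hdirac.of_comp (L := evalCLM 𝕜 X t) (norm_diracTensor t)⟩

end T35Space

end WC

theorem theorem4p1_general {𝕜 : Type*} [RCLike 𝕜]
    {Ω : Type*} [TopologicalSpace Ω] [T35Space Ω] [Nonempty Ω]
    {X : Type*} [NormedAddCommGroup X] [NormedSpace 𝕜 X] [Nontrivial X]
    (Λ : StrongDual 𝕜 (WC 𝕜 Ω X)) (hΛ : IsWeakStarWeakPC 𝕜 Λ) :
    ∃ (J : Set ℕ) (α : ℕ → ℝ) (ω : ℕ → Ω) (x : ℕ → StrongDual 𝕜 X),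
      Set.InjOn ω J ∧
      (∀ i ∈ J, 0 < α i ∧ α i ≤ 1 ∧ IsOpen ({ω i} : Set Ω) ∧ IsWeakStarWeakPC 𝕜 (x i)) ∧
      HasSum (fun i : J => α i) 1 ∧
      HasSum (fun i : J => ((α i : ℝ) : 𝕜) • WC.diracTensor (ω i) (x i)) Λ := by
  obtain ⟨a, x, ha, ha_sum, hPC, hsum⟩ := WC.exists_hasSum_smul_diracTensor hΛ
  obtain ⟨J, ω, hω, ha_sum_nat, hsum_nat⟩ := exists_bijOn_support_hasSum ha_sum hsum
  refine ⟨J, a ∘ ω, ω, x ∘ ω, hω.injOn, fun i hi => ?_, ha_sum_nat, hsum_nat⟩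
  have hai : a (ω i) ≠ 0 := hω.mapsTo hi
  exact ⟨(ha _).lt_of_ne' hai, le_hasSum ha_sum _ fun t _ => ha t, hPC _ hai⟩

theorem theorem4p1 {𝕜 : Type*} [RCLike 𝕜]
    {Ω : Type*} [TopologicalSpace Ω] [CompactSpace Ω] [T2Space Ω] [Nonempty Ω]
    {X : Type*} [NormedAddCommGroup X] [NormedSpace 𝕜 X] [CompleteSpace X] [Nontrivial X]
    (Λ : StrongDual 𝕜 (WC 𝕜 Ω X)) (hΛ : IsWeakStarWeakPC 𝕜 Λ) :
    ∃ (J : Set ℕ) (α : ℕ → ℝ) (ω : ℕ → Ω) (x : ℕ → StrongDual 𝕜 X),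
      Set.InjOn ω J ∧
      (∀ i ∈ J, 0 < α i ∧ α i ≤ 1 ∧ IsOpen ({ω i} : Set Ω) ∧ IsWeakStarWeakPC 𝕜 (x i)) ∧
      HasSum (fun i : J => α i) 1 ∧
      HasSum (fun i : J => ((α i : ℝ) : 𝕜) • WC.diracTensor (ω i) (x i)) Λ :=
  theorem4p1_general Λ hΛ
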